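/- Let $k$ be a perfect field of characteristic $p \ge 3$, let $W_2(k)$ be its ring of Witt vectors of length two, with reduction map $W_2(k) \to k$, $(a_0,a_1)\mapsto a_0$, and Frobenius $\sigma(a_0,a_1) = (a_0^p,a_1^p)$. A $k$-scheme $X$ is said to admit a $W_2(k)$-lifting compatible with Frobenius if there exist a flat morphism $\widetilde X \to \operatorname{Spec} W_2(k)$, an isomorphism of $k$-schemes $X \simeq \widetilde X \times_{\operatorname{Spec} W_2(k)} \operatorname{Spec} k$ with induced closed immersion $i\colon X \to \widetilde X$, and a morphism $\widetilde F \colon \widetilde X \to \widetilde X$ lying over $\operatorname{Spec}(\sigma)$ such that $\widetilde F \circ i = i \circ F_X$, where $F_X$ is the absolute Frobenius morphism of $X$ (the identity on points and $s \mapsto s^p$ on sections). Let $n \ge 5$ and let $Q \in k[x_1,\dots,x_n]$ be a polynomial all of whose monomials have degree at least $3$ (for instance $Q = 0$). Then the ordinary double point $$\operatorname{Spec}\, k[x_1,\dots,x_n]/(x_1^2 + \dots + x_n^2 + Q)$$ does not admit a $W_2(k)$-lifting compatible with Frobenius. -/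

import Mathlib

open CategoryTheory AlgebraicGeometry Opposite

/-- The `p`-th power map on a commutative ring in which `p = 0` (the zero ring is allowed). -/
def powerHom (p : ℕ) [Fact p.Prime] (R : Type*) [CommRing R] (h : (p : R) = 0) : R →+* R where
  toFun x := x ^ p
  map_one' := one_pow p
  map_mul' x y := mul_pow x y p
  map_zero' := zero_pow (Fact.out : p.Prime).ne_zero
  map_add' x y := by
    obtain ⟨r, hr⟩ := exists_add_pow_prime_eq (Fact.out : p.Prime) x y
    rw [hr, h]
    ring

theorem natCast_section_eq_zero {X : Scheme} {p : ℕ} (h : (p : Γ(X, ⊤)) = 0) (U : X.Opens) :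
    (p : Γ(X, U)) = 0 := by
  have := congrArg (X.presheaf.map (homOfLE (le_top : U ≤ ⊤)).op).hom h
  simpa using this

/-- The absolute Frobenius as a morphism of presheafed spaces: the identity on points and
`s ↦ s ^ p` on sections. -/
noncomputable def absoluteFrobeniusPsh (p : ℕ) [Fact p.Prime] (X : Scheme)
    (h : (p : Γ(X, ⊤)) = 0) :
    PresheafedSpace.Hom X.toPresheafedSpace X.toPresheafedSpace where
  base := 𝟙 _
  c :=
    { app := fun U => CommRingCat.ofHom
        (powerHom p Γ(X, unop U) (natCast_section_eq_zero h (unop U)))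
      naturality := fun U V i => by
        ext s
        exact (map_pow (X.presheaf.map i).hom s p).symm }

theorem absoluteFrobeniusPsh_stalkMap (p : ℕ) [Fact p.Prime] (X : Scheme)
    (h : (p : Γ(X, ⊤)) = 0) (x : X)
    (s : X.presheaf.stalk x) :
    (PresheafedSpace.Hom.stalkMap (absoluteFrobeniusPsh p X h) x).hom s = s ^ p := by
  obtain ⟨U, hx, s, rfl⟩ := X.presheaf.exists_germ_eq s
  have := PresheafedSpace.stalkMap_germ_apply (absoluteFrobeniusPsh p X h) U x hx s
  refine Eq.trans this ?_
  exact map_pow (X.presheaf.germ U x hx).hom s p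

/-- The absolute Frobenius `F_X : X ⟶ X` of a scheme `X` on which `p = 0`. -/
noncomputable def absoluteFrobenius (p : ℕ) [Fact p.Prime] (X : Scheme)
    (h : (p : Γ(X, ⊤)) = 0) : X ⟶ X where
  toHom := absoluteFrobeniusPsh p X h
  prop x := ⟨fun s hs => by
    have hs' := hs
    erw [absoluteFrobeniusPsh_stalkMap p X h x s] at hs'
    exact (isUnit_pow_iff (Fact.out : p.Prime).ne_zero).1 hs'⟩

/-- `W₂(k)`, the ring of Witt vectors of length two. -/
abbrev WittTwo (p : ℕ) [Fact p.Prime] (k : Type*) [CommRing k] : Type _ :=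
  TruncatedWittVector p 2 k

/-- The reduction `W₂(k) → k`, `(a₀, a₁) ↦ a₀`. -/
noncomputable def wittTwoResidue (p : ℕ) [Fact p.Prime] (k : Type*) [CommRing k] :
    WittTwo p k →+* k where
  toFun x := x.coeff 0
  map_one' := by
    rw [← map_one (WittVector.truncate (p := p) (R := k) 2), WittVector.coeff_truncate]; simp
  map_zero' := by simp
  map_mul' x y := by
    obtain ⟨x, rfl⟩ := WittVector.truncate_surjective p 2 k x
    obtain ⟨y, rfl⟩ := WittVector.truncate_surjective p 2 k y
    simp only [← map_mul, WittVector.coeff_truncate]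
    exact WittVector.mul_coeff_zero x y
  map_add' x y := by
    obtain ⟨x, rfl⟩ := WittVector.truncate_surjective p 2 k x
    obtain ⟨y, rfl⟩ := WittVector.truncate_surjective p 2 k y
    simp only [← map_add, WittVector.coeff_truncate]
    exact WittVector.add_coeff_zero x y

theorem wittTwo_mk_truncate (p : ℕ) [Fact p.Prime] (k : Type*) [CommRing k] [CharP k p]
    (x : WittVector p k) :
    TruncatedWittVector.mk p (fun i => (WittVector.truncate 2 x).coeff i ^ p) =
      WittVector.truncate 2 (WittVector.frobenius x) := by
  ext i
  simp [WittVector.coeff_truncate, WittVector.coeff_frobenius_charP]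

/-- The Frobenius `σ : W₂(k) → W₂(k)`, `(a₀, a₁) ↦ (a₀ ^ p, a₁ ^ p)`. -/
noncomputable def wittTwoFrobenius (p : ℕ) [Fact p.Prime] (k : Type*) [CommRing k] [CharP k p] :
    WittTwo p k →+* WittTwo p k where
  toFun x := TruncatedWittVector.mk p fun i => x.coeff i ^ p
  map_one' := by
    rw [← map_one (WittVector.truncate (p := p) (R := k) 2), wittTwo_mk_truncate, map_one]
  map_zero' := by
    rw [← map_zero (WittVector.truncate (p := p) (R := k) 2), wittTwo_mk_truncate, map_zero]
  map_mul' x y := by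
    obtain ⟨x, rfl⟩ := WittVector.truncate_surjective p 2 k x
    obtain ⟨y, rfl⟩ := WittVector.truncate_surjective p 2 k y
    rw [← map_mul, wittTwo_mk_truncate, wittTwo_mk_truncate, wittTwo_mk_truncate, map_mul, map_mul]
  map_add' x y := by
    obtain ⟨x, rfl⟩ := WittVector.truncate_surjective p 2 k x
    obtain ⟨y, rfl⟩ := WittVector.truncate_surjective p 2 k y
    rw [← map_add, wittTwo_mk_truncate, wittTwo_mk_truncate, wittTwo_mk_truncate, map_add, map_add]

universe u

/-- A lifting of `s : X ⟶ S` along `j : S ⟶ T`: a flat morphism `π : total ⟶ T` together with an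
isomorphism of `X` with `total ×_T S` over `S`, recorded as a cartesian square. -/
structure FlatLifting {X S T : Scheme.{u}} (s : X ⟶ S) (j : S ⟶ T) where
  total : Scheme.{u}
  π : total ⟶ T
  i : X ⟶ total
  flat : Flat π
  isPullback : IsPullback i s π j

theorem natCast_eq_zero_of_over {p : ℕ} {k : Type u} [CommRing k] [CharP k p] {X : Scheme.{u}}
    (s : X ⟶ Spec (CommRingCat.of k)) : (p : Γ(X, ⊤)) = 0 := by
  have h := congrArg ((Scheme.ΓSpecIso (CommRingCat.of k)).inv ≫ s.appTop).hom
    (CharP.cast_eq_zero k p)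
  rw [map_natCast, map_zero] at h
  exact h

/-- `X` over `k` admits a `W₂(k)`-lifting compatible with Frobenius: a flat lifting `X'` over
`W₂(k)` with an endomorphism of `X'` over `σ` that restricts to the absolute Frobenius of `X`. -/
def IsFrobeniusLiftable (p : ℕ) [Fact p.Prime] {k : Type u} [Field k] [CharP k p]
    {X : Scheme.{u}} (s : X ⟶ Spec (CommRingCat.of k)) : Prop :=
  ∃ (L : FlatLifting s (Spec.map (CommRingCat.ofHom (wittTwoResidue p k))))
    (F : L.total ⟶ L.total),
    F ≫ L.π = L.π ≫ Spec.map (CommRingCat.ofHom (wittTwoFrobenius p k)) ∧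
    L.i ≫ F = absoluteFrobenius p X (natCast_eq_zero_of_over s) ≫ L.i

/-- The affine hypersurface `Spec k[x₁, …, xₙ]/(f)`. -/
noncomputable abbrev hypersurface {k : Type u} [Field k] {n : ℕ} (f : MvPolynomial (Fin n) k) :
    Scheme.{u} :=
  Spec (CommRingCat.of (MvPolynomial (Fin n) k ⧸ Ideal.span {f}))

/-- The structure morphism of the hypersurface `f = 0` over `k`. -/
noncomputable abbrev hypersurfaceToSpec {k : Type u} [Field k] {n : ℕ}
    (f : MvPolynomial (Fin n) k) : hypersurface f ⟶ Spec (CommRingCat.of k) :=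
  Spec.map (CommRingCat.ofHom (algebraMap k (MvPolynomial (Fin n) k ⧸ Ideal.span {f})))

/-! Write `[a]` for the Teichmüller representative in `W₂` and `V(a)` for `(0, a)`. A flat lift `A`
of an affine chart `B`, with a lift `φ` of Frobenius, sends every point `B → C` with `p = 0` in `C`
to a ring map `ψ : A → W₂(C)` above it (`exists_ringHom_wittTwo`): the ghost vector `(a, φ a)`
determines a Witt vector up to `p`-torsion, and flatness puts that torsion in `pA`, which dies in
`C`. Lifting the equation `f = 0` to `f(x) = p g` in `A` and applying `ψ` gives an equation in
`W₂(C)` whose right side is `p ψ(g) = V(γ ^ p)`, where `γ ∈ C`.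

The contradiction comes from a suitable local Artinian `C`. Its maximal ideal `I` satisfies `a ^ p =
0` for `a ∈ I`, and `I ^ (2p + 1) = 0`. Since `V(a) x = V(a x₀ ^ p)`, products of elements of
`W₂(C)` lying over `I` depend only on their zeroth coordinates. Terms of order at least three add to
quadratic ones without carry, because that carry lies in `I ^ (2p + 1)`. A Morse change of
coordinates therefore reduces the equation to `∑ [y i ^ 2] = V(γ ^ p)` for a chosen point `y` of the
quadric `∑ y i ^ 2 = 0` (`exists_sum_teich_sq_eq`).

Five variables allow the point to be written as `uv + wz + t² = 0`, with `[uv] + [wz] + [t²] =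
V(-(uv) ^ (p - 1) t²)`; with only two summands, `[-a] = -[a]` would make the sum vanish. The ring of
`exists_quadric_test_ring` keeps `(uv) ^ (p - 1) t²`, of degree `2p`, nonzero. But `γ` is a constant
modulo `I`, so `γ ^ p` is the `p`-th power of a constant and cannot be a nonzero nilpotent. -/

/-! ### Arithmetic of `W₂` and the Teichmüller carry -/

theorem natCast_mul_choose_div {p i : ℕ} (hp : p.Prime) (h0 : i ≠ 0) (hi : i < p) :
    p * (p.choose i / p) = p.choose i :=
  Nat.mul_div_cancel' (hp.dvd_choose_self h0 hi)

/-- The integral polynomial `(a ^ p + b ^ p - (a + b) ^ p) / p`. -/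
def wittCarry (p : ℕ) {R : Type*} [CommRing R] (a b : R) : R :=
  -∑ i ∈ Finset.Ioo 0 p, ((p.choose i / p : ℕ) : R) * (a ^ i * b ^ (p - i))

theorem map_wittCarry (p : ℕ) {R S : Type*} [CommRing R] [CommRing S] (f : R →+* S) (a b : R) :
    f (wittCarry p a b) = wittCarry p (f a) (f b) := by
  simp [wittCarry]

theorem natCast_mul_wittCarry {p : ℕ} (hp : p.Prime) {R : Type*} [CommRing R] (a b : R) :
    (p : R) * wittCarry p a b = a ^ p + b ^ p - (a + b) ^ p := by
  have h : (a + b) ^ p = a ^ p + b ^ p +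
      ∑ i ∈ Finset.Ioo 0 p, ((p.choose i : ℕ) : R) * (a ^ i * b ^ (p - i)) := by
    rw [add_pow, Finset.sum_range_succ, Finset.range_eq_Ico,
      Finset.sum_eq_sum_Ico_succ_bot hp.pos]
    have : Finset.Ico (0 + 1) p = Finset.Ioo 0 p := by ext; simp; omega
    rw [this]
    simp only [pow_zero, Nat.sub_zero, one_mul, Nat.choose_zero_right, Nat.cast_one, mul_one,
      Nat.sub_self, Nat.choose_self]
    rw [Finset.sum_congr rfl fun i _ => mul_comm _ _]
    ring
  rw [h, wittCarry, mul_neg, Finset.mul_sum, Finset.sum_congr rfl (g := fun i =>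
    ((p.choose i : ℕ) : R) * (a ^ i * b ^ (p - i)))]
  · ring
  · intro i hi
    rw [Finset.mem_Ioo] at hi
    rw [← mul_assoc, ← Nat.cast_mul, natCast_mul_choose_div hp (by omega) hi.2]

section

variable (p : ℕ) [hp : Fact p.Prime]

theorem ghostComponent_one_eq {R : Type*} [CommRing R] (x : WittVector p R) :
    WittVector.ghostComponent 1 x = x.coeff 0 ^ p + p * x.coeff 1 := by
  rw [WittVector.ghostComponent_apply, wittPolynomial_one]
  simp; ring

theorem ghostComponent_zero_eq {R : Type*} [CommRing R] (x : WittVector p R) :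
    WittVector.ghostComponent 0 x = x.coeff 0 := by
  rw [WittVector.ghostComponent_apply, wittPolynomial_zero]
  simp

/-- The identity is universal: over `ℤ[X₀, X₁]` one may cancel `p` in the first ghost component, and
every other case is a specialization. -/
theorem teichmuller_add_coeff_one {R : Type*} [CommRing R] (a b : R) :
    (WittVector.teichmuller p a + WittVector.teichmuller p b).coeff 1 = wittCarry p a b := by
  have key : (WittVector.teichmuller p (MvPolynomial.X 0 : MvPolynomial (Fin 2) ℤ) +
      WittVector.teichmuller p (MvPolynomial.X 1)).coeff 1 =
      wittCarry p (MvPolynomial.X 0) (MvPolynomial.X 1) := by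
    have h := congrArg₂ (· + ·) (WittVector.ghostComponent_teichmuller (p := p)
      (MvPolynomial.X 0 : MvPolynomial (Fin 2) ℤ) 1)
      (WittVector.ghostComponent_teichmuller (p := p) (MvPolynomial.X 1 : MvPolynomial (Fin 2) ℤ) 1)
    rw [← map_add, ghostComponent_one_eq, WittVector.add_coeff_zero,
      WittVector.teichmuller_coeff_zero, WittVector.teichmuller_coeff_zero, pow_one] at h
    have hp0 : (p : MvPolynomial (Fin 2) ℤ) ≠ 0 := Nat.cast_ne_zero.2 hp.out.ne_zero
    refine mul_left_cancel₀ hp0 ?_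
    rw [natCast_mul_wittCarry hp.out, ← h]
    ring
  have := congrArg (MvPolynomial.eval₂Hom (Int.castRingHom R) ![a, b]) key
  rw [map_wittCarry, ← WittVector.map_coeff, map_add, WittVector.map_teichmuller,
    WittVector.map_teichmuller] at this
  simpa using this

/-- The Teichmüller representative in `W₂`. -/
noncomputable def teich {R : Type*} [CommRing R] : R →* WittTwo p R :=
  (WittVector.truncate 2 : WittVector p R →+* _).toMonoidHom.comp (WittVector.teichmuller p)

theorem teich_eq_truncate {R : Type*} [CommRing R] (a : R) :
    teich p a = WittVector.truncate 2 (WittVector.teichmuller p a) := rfl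

theorem wittTwo_ext {R : Type*} [CommRing R] {x y : WittTwo p R} (h0 : x.coeff 0 = y.coeff 0)
    (h1 : x.coeff 1 = y.coeff 1) : x = y := by
  ext i
  fin_cases i
  · exact h0
  · exact h1

/-- The element `(0, a)` of `W₂`. -/
def wittV {R : Type*} [CommRing R] (a : R) : WittTwo p R := TruncatedWittVector.mk p ![0, a]

variable {p} {R : Type*} [CommRing R]

@[simp] theorem wittV_coeff_zero (a : R) : (wittV p a).coeff 0 = 0 := rfl
@[simp] theorem wittV_coeff_one (a : R) : (wittV p a).coeff 1 = a := rfl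

@[simp] theorem teich_coeff_zero (a : R) : (teich p a).coeff 0 = a := by
  rw [teich_eq_truncate, WittVector.coeff_truncate]
  exact WittVector.teichmuller_coeff_zero p a

@[simp] theorem teich_coeff_one (a : R) : (teich p a).coeff 1 = 0 := by
  rw [teich_eq_truncate, WittVector.coeff_truncate]
  exact WittVector.teichmuller_coeff_pos p a 1 one_pos

@[simp] theorem teich_zero : teich p (0 : R) = 0 := by
  apply wittTwo_ext <;> simp

theorem wittV_eq_truncate (a : R) : wittV p a =
    WittVector.truncate 2 (WittVector.verschiebung (WittVector.teichmuller p a)) := by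
  apply wittTwo_ext
  · rw [WittVector.coeff_truncate]; simp
  · rw [WittVector.coeff_truncate, wittV_coeff_one]
    exact (WittVector.teichmuller_coeff_zero p a).symm

theorem teich_add_wittV (a b : R) :
    teich p a + wittV p b = TruncatedWittVector.mk p ![a, b] := by
  rw [wittV_eq_truncate, teich_eq_truncate, ← map_add]
  have h : ∀ n, (WittVector.teichmuller p a).coeff n = 0 ∨
      (WittVector.verschiebung (WittVector.teichmuller p b)).coeff n = 0 := by
    rintro (_ | n)
    · right; simp
    · left; exact WittVector.teichmuller_coeff_pos p a _ n.succ_pos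
  apply wittTwo_ext
  · rw [WittVector.coeff_truncate, WittVector.coeff_add_of_disjoint _ _ _ h]
    simp [TruncatedWittVector.coeff_mk]
  · rw [WittVector.coeff_truncate, WittVector.coeff_add_of_disjoint _ _ _ h]
    have := WittVector.teichmuller_coeff_pos p a 1 one_pos
    have h2 := WittVector.verschiebung_coeff_add_one (WittVector.teichmuller p b) 0
    simp only [zero_add] at h2
    simp [TruncatedWittVector.coeff_mk, this, h2]

theorem eq_teich_add_wittV (x : WittTwo p R) : x = teich p (x.coeff 0) + wittV p (x.coeff 1) := by
  rw [teich_add_wittV]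
  exact wittTwo_ext _ rfl rfl

theorem teich_add_teich (a b : R) :
    teich p a + teich p b = teich p (a + b) + wittV p (wittCarry p a b) := by
  rw [teich_add_wittV, teich_eq_truncate, teich_eq_truncate, ← map_add]
  apply wittTwo_ext
  · rw [WittVector.coeff_truncate]; simp [TruncatedWittVector.coeff_mk, WittVector.add_coeff_zero]
  · rw [WittVector.coeff_truncate]
    exact teichmuller_add_coeff_one p a b

theorem wittV_injective : Function.Injective (wittV p : R → WittTwo p R) := fun a b h => by
  simpa using congrArg (fun x => TruncatedWittVector.coeff 1 x) h

theorem wittTwo_add_coeff_zero (x y : WittTwo p R) :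
    (x + y).coeff 0 = x.coeff 0 + y.coeff 0 := map_add (wittTwoResidue p R) x y

theorem wittTwo_mul_coeff_zero (x y : WittTwo p R) :
    (x * y).coeff 0 = x.coeff 0 * y.coeff 0 := map_mul (wittTwoResidue p R) x y

/-- For odd `p` the carry of `a` and `-a` vanishes, as is seen over `ℤ[X]`, where `p` can be
cancelled. -/
theorem teich_neg (hp2 : p ≠ 2) (a : R) : teich p (-a) = -teich p a := by
  have h : wittCarry p a (-a) = 0 := by
    have := map_wittCarry p (MvPolynomial.eval₂Hom (Int.castRingHom R) ![a])
      (MvPolynomial.X 0) (-MvPolynomial.X 0)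
    have hp0 : (p : MvPolynomial (Fin 1) ℤ) ≠ 0 := Nat.cast_ne_zero.2 hp.out.ne_zero
    have h0 : wittCarry p (MvPolynomial.X 0) (-MvPolynomial.X 0 : MvPolynomial (Fin 1) ℤ) = 0 := by
      refine mul_left_cancel₀ hp0 ?_
      rw [natCast_mul_wittCarry hp.out, (hp.out.odd_of_ne_two hp2).neg_pow]
      simp [hp.out.ne_zero]
    rw [h0] at this
    simpa using this.symm
  have := teich_add_teich (p := p) a (-a)
  rw [h, add_neg_cancel, teich_zero, zero_add] at this
  rw [eq_neg_iff_add_eq_zero, add_comm, this]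
  exact wittTwo_ext _ (by simp) (by simp)

variable [CharP R p]

/-- The projection formula `V(a · F x) = V(a) · x`, with `F` the coordinatewise `p`-th power in
characteristic `p`. -/
theorem wittV_mul (a : R) (x : WittTwo p R) : wittV p a * x = wittV p (a * x.coeff 0 ^ p) := by
  obtain ⟨x, rfl⟩ := WittVector.truncate_surjective p 2 R x
  rw [wittV_eq_truncate, ← map_mul, ← WittVector.verschiebung_mul_frobenius]
  have h2 := WittVector.verschiebung_coeff_add_one
    (WittVector.teichmuller p a * WittVector.frobenius x) 0
  simp only [zero_add] at h2
  apply wittTwo_ext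
  · rw [WittVector.coeff_truncate]; simp
  · rw [WittVector.coeff_truncate, WittVector.coeff_truncate, wittV_coeff_one]
    refine h2.trans ?_
    simp [WittVector.mul_coeff_zero, WittVector.coeff_frobenius_charP]

theorem mul_natCast_eq_wittV (x : WittTwo p R) : x * p = wittV p (x.coeff 0 ^ p) := by
  obtain ⟨x, rfl⟩ := WittVector.truncate_surjective p 2 R x
  rw [← map_natCast (WittVector.truncate (p := p) 2), ← map_mul]
  apply wittTwo_ext
  · rw [WittVector.coeff_truncate]; simp [WittVector.mul_charP_coeff_zero]
  · rw [WittVector.coeff_truncate, WittVector.coeff_truncate, wittV_coeff_one]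
    exact WittVector.mul_charP_coeff_succ x 0

/-- Multiplication by an element whose zeroth coordinate has vanishing `p`-th power only sees
the zeroth coordinate of the other factor. -/
theorem mul_eq_mul_of_coeff_zero {x y z : WittTwo p R} (hxy : x.coeff 0 = y.coeff 0)
    (hz : z.coeff 0 ^ p = 0) : x * z = y * z := by
  rw [eq_teich_add_wittV x, eq_teich_add_wittV y, add_mul, add_mul, wittV_mul, wittV_mul, hz, hxy,
    mul_zero, mul_zero]

theorem mul_eq_teich {x y : WittTwo p R} (hx : x.coeff 0 ^ p = 0) (hy : y.coeff 0 ^ p = 0) :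
    x * y = teich p (x.coeff 0 * y.coeff 0) := by
  rw [mul_eq_mul_of_coeff_zero (y := teich p (x.coeff 0)) (by simp) hy, mul_comm,
    mul_eq_mul_of_coeff_zero (y := teich p (y.coeff 0)) (by simp) (by simpa), ← map_mul, mul_comm]

theorem mul_teich_eq {x : WittTwo p R} {a : R} (ha : a ^ p = 0) :
    x * teich p a = teich p (x.coeff 0 * a) := by
  rw [mul_eq_mul_of_coeff_zero (y := teich p (x.coeff 0)) (by simp) (by simpa), ← map_mul]

/-- The carry of `[a] + [a']` is killed by `[b]`, since `V(c) [b] = V(c b ^ p)`. -/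
theorem teich_add_mul {a a' b : R} (hb : b ^ p = 0) :
    teich p ((a + a') * b) = teich p (a * b) + teich p (a' * b) := by
  rw [map_mul, map_mul, map_mul, ← add_mul]
  exact mul_eq_mul_of_coeff_zero (by simp [wittTwo_add_coeff_zero]) (by simpa)

end

/-! ### From Frobenius lifts to maps into `W₂` -/

/-- A lift of Frobenius on `A` turns a homomorphism `A → C` killing the `p`-torsion into a
homomorphism to `W₂(C)`. -/
theorem exists_ringHom_wittTwo {p : ℕ} [hp : Fact p.Prime] {A C : Type*} [CommRing A] [CommRing C]
    [CharP C p] (π : A →+* C) (hπ : ∀ a, (p : A) * a = 0 → π a = 0) (φ : A →+* A)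
    (hφ : ∀ a, ∃ d, φ a = a ^ p + p * d) :
    ∃ ψ : A →+* WittTwo p C, ∀ a, (ψ a).coeff 0 = π a := by
  let w0 : WittVector p A →+* A := WittVector.ghostComponent 0
  let w1 : WittVector p A →+* A := WittVector.ghostComponent 1
  -- `Γ` consists of the Witt vectors with ghost components `(a, φ a)`. It surjects onto `A`, and
  -- the map to `W₂(C)` descends along this surjection.
  let Γ := RingHom.eqLocus w1 (φ.comp w0)
  let f : Γ →+* A := w0.comp Γ.subtype
  let g : Γ →+* WittTwo p C :=
    ((WittVector.truncate 2).comp (WittVector.map π)).comp Γ.subtype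
  have hw0 : ∀ x, w0 x = x.coeff 0 := ghostComponent_zero_eq p
  have hw1 : ∀ x, w1 x = x.coeff 0 ^ p + p * x.coeff 1 := ghostComponent_one_eq p
  have hf : Function.Surjective f := by
    intro a
    obtain ⟨d, hd⟩ := hφ a
    let x : WittVector p A := WittVector.mk p fun i => if i = 0 then a else if i = 1 then d else 0
    have h0 : x.coeff 0 = a := rfl
    have h1 : x.coeff 1 = d := rfl
    refine ⟨⟨x, ?_⟩, ?_⟩
    · change w1 x = φ (w0 x)
      rw [hw1, hw0, h0, h1, hd]
    · change w0 x = a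
      rw [hw0, h0]
  have hg0 : ∀ x : Γ, (g x).coeff 0 = π (f x) := by
    intro x
    change TruncatedWittVector.coeff 0 (WittVector.truncate 2 (WittVector.map π x.1)) = π (w0 x.1)
    rw [WittVector.coeff_truncate, hw0]
    simp
  have hker : RingHom.ker f ≤ RingHom.ker g := by
    intro x hx
    rw [RingHom.mem_ker] at hx ⊢
    have hx0 : w0 x.1 = 0 := hx
    have hx1 : w1 x.1 = φ (w0 x.1) := x.2
    -- On the kernel the ghost equation becomes `p x₁ = 0`, so `π` kills `x₁`.
    rw [hx0, map_zero, hw1, ← hw0, hx0, zero_pow hp.out.ne_zero, zero_add] at hx1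
    apply wittTwo_ext
    · rw [hg0, hx, map_zero]; simp
    · change TruncatedWittVector.coeff 1 (WittVector.truncate 2 (WittVector.map π x.1)) = _
      rw [WittVector.coeff_truncate, TruncatedWittVector.coeff_zero, WittVector.map_coeff]
      exact hπ _ hx1
  refine ⟨f.liftOfRightInverse _ (Function.rightInverse_surjInv hf) ⟨g, hker⟩, fun a => ?_⟩
  obtain ⟨x, rfl⟩ := hf a
  rw [RingHom.liftOfRightInverse_comp_apply, hg0]

/-! ### Monomials and carry-free addition over a nilpotent ideal -/

theorem Finsupp.exists_eq_single_add {σ : Type*} {m : σ →₀ ℕ} (hm : 1 ≤ m.degree) :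
    ∃ i m', m = Finsupp.single i 1 + m' := by
  obtain ⟨i, hi⟩ : ∃ i, m i ≠ 0 := by
    by_contra! h
    have : m = 0 := Finsupp.ext h
    simp [this] at hm
  exact ⟨i, m - Finsupp.single i 1, (add_tsub_cancel_of_le (by
    rw [Finsupp.single_le_iff]; omega)).symm⟩

theorem Finsupp.prod_single_add_pow {σ C : Type*} [CommRing C] (f : σ → C) (m : σ →₀ ℕ) (i : σ) :
    ((Finsupp.single i 1 + m).prod fun i e => f i ^ e) = f i * m.prod fun i e => f i ^ e := by
  rw [Finsupp.prod_add_index' (by simp) (by intros; rw [pow_add]),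
    Finsupp.prod_single_index (by simp), pow_one]

section

variable {p : ℕ} [hp : Fact p.Prime] {C : Type*} [CommRing C]

/-- Two factors are needed: each one erases the `V`-part of the other, whereas a single `ξ i` may
have an arbitrary `V`-part. -/
theorem prod_eq_teich [CharP C p] {σ : Type*} (ξ : σ → WittTwo p C)
    (hξ : ∀ i, (ξ i).coeff 0 ^ p = 0) (m : σ →₀ ℕ) (hm : 2 ≤ m.degree) :
    (m.prod fun i e => ξ i ^ e) = teich p (m.prod fun i e => (ξ i).coeff 0 ^ e) := by
  have hprod : ∀ m : σ →₀ ℕ, (m.prod fun i e => ξ i ^ e).coeff 0 =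
      m.prod fun i e => (ξ i).coeff 0 ^ e := fun m => by
    refine (map_finsuppProd (wittTwoResidue p C) m fun i e => ξ i ^ e).trans ?_
    simp only [map_pow]
    rfl
  obtain ⟨i, m', rfl⟩ := Finsupp.exists_eq_single_add (m := m) (by omega)
  obtain ⟨j, m'', rfl⟩ := Finsupp.exists_eq_single_add (m := m') (by
    simp only [map_add, Finsupp.degree_single] at hm; omega)
  rw [Finsupp.prod_single_add_pow, Finsupp.prod_single_add_pow (fun i => (ξ i).coeff 0),
    mul_eq_teich (hξ i), hprod]
  rw [hprod, Finsupp.prod_single_add_pow (fun i => (ξ i).coeff 0), mul_pow, hξ, zero_mul]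

/-- Every carry term `a ^ i b ^ (p - i)` has `i < p`, hence order at least `2i + 3(p - i) ≥ 2p + 1`.
-/
theorem teich_add_of_mem {I : Ideal C} (hI : I ^ (2 * p + 1) = ⊥) {a b : C}
    (ha : a ∈ I ^ 2) (hb : b ∈ I ^ 3) :
    teich p (a + b) = teich p a + teich p b := by
  have h : wittCarry p a b = 0 := by
    rw [wittCarry, neg_eq_zero]
    refine Finset.sum_eq_zero fun i hi => ?_
    rw [Finset.mem_Ioo] at hi
    have h1 : a ^ i * b ^ (p - i) ∈ I ^ (2 * i + 3 * (p - i)) := by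
      rw [pow_add, pow_mul, pow_mul]
      exact Ideal.mul_mem_mul (Ideal.pow_mem_pow ha _) (Ideal.pow_mem_pow hb _)
    have h2 := Ideal.pow_le_pow_right (show 2 * p + 1 ≤ 2 * i + 3 * (p - i) by omega) h1
    rw [hI, Ideal.mem_bot] at h2
    rw [h2, mul_zero]
  rw [teich_add_teich, h]
  have : wittV p (0 : C) = 0 := wittTwo_ext p (by simp) (by simp)
  rw [this, add_zero]

theorem teich_sum_of_mem {I : Ideal C} (hI : I ^ (2 * p + 1) = ⊥) {ι : Type*}
    (s : Finset ι) (b : ι → C) (hb : ∀ i ∈ s, b i ∈ I ^ 3) :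
    teich p (∑ i ∈ s, b i) = ∑ i ∈ s, teich p (b i) := by
  classical
  induction s using Finset.induction_on with
  | empty => simp
  | insert i s hi ih =>
    rw [Finset.sum_insert hi, Finset.sum_insert hi, teich_add_of_mem hI, ih]
    · exact fun j hj => hb j (Finset.mem_insert_of_mem hj)
    · exact Ideal.pow_le_pow_right (by omega) (hb i (Finset.mem_insert_self _ _))
    · exact sum_mem fun j hj => hb j (Finset.mem_insert_of_mem hj)

end

/-! ### Morse coordinates modulo powers of an ideal -/

section

variable {k C σ : Type*} [Field k] [CommRing C] [Algebra k C] {I : Ideal C}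

theorem Finsupp.prod_pow_mem {c : σ → C} (hc : ∀ i, c i ∈ I) (m : σ →₀ ℕ) :
    (m.prod fun i e => c i ^ e) ∈ I ^ m.degree := by
  obtain ⟨d, hd⟩ : ∃ d, m.degree = d := ⟨_, rfl⟩
  induction d generalizing m with
  | zero => simp [hd]
  | succ d ih =>
    obtain ⟨i, m', rfl⟩ := Finsupp.exists_eq_single_add (m := m) (by omega)
    have h : m'.degree = d := by
      rw [map_add, Finsupp.degree_single] at hd; omega
    rw [Finsupp.prod_single_add_pow, hd, pow_succ']
    exact Ideal.mul_mem_mul (hc i) (h ▸ ih m' h)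

theorem Finsupp.prod_pow_sub_mem {c c' : σ → C} (hc : ∀ i, c i ∈ I) {e : ℕ} (he : 1 ≤ e)
    (hcc : ∀ i, c' i - c i ∈ I ^ e) (m : σ →₀ ℕ) (j : ℕ) (hm : j + 1 ≤ m.degree) :
    (m.prod fun i e => c' i ^ e) - (m.prod fun i e => c i ^ e) ∈ I ^ (e + j) := by
  have hc' : ∀ i, c' i ∈ I := fun i => by
    have := I.add_mem (Ideal.pow_le_self (by omega) (hcc i)) (hc i)
    simpa using this
  induction j generalizing m with
  | zero =>
    obtain ⟨d, hd⟩ : ∃ d, m.degree = d := ⟨_, rfl⟩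
    clear hm
    induction d generalizing m with
    | zero =>
      rw [Finsupp.degree_eq_zero_iff] at hd
      simp [hd]
    | succ d ih =>
      obtain ⟨i, m', rfl⟩ := Finsupp.exists_eq_single_add (m := m) (by omega)
      rw [Finsupp.prod_single_add_pow, Finsupp.prod_single_add_pow]
      have h := ih m' (by rw [map_add, Finsupp.degree_single] at hd; omega)
      have := Ideal.add_mem _ (Ideal.mul_mem_left _ (c' i) h)
        (Ideal.mul_mem_right (m'.prod fun i e => c i ^ e) _ (hcc i))
      convert this using 1
      ring
  | succ j ih =>
    obtain ⟨i, m', rfl⟩ := Finsupp.exists_eq_single_add (m := m) (by omega)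
    rw [Finsupp.prod_single_add_pow, Finsupp.prod_single_add_pow]
    rw [map_add, Finsupp.degree_single] at hm
    have h := Ideal.mul_mem_mul (hc' i) (ih m' (by omega))
    rw [← pow_succ'] at h
    have h2 := Ideal.mul_mem_mul (hcc i) (Ideal.pow_le_pow_right (show j + 1 ≤ _ by omega)
      (Finsupp.prod_pow_mem hc m'))
    rw [← pow_add] at h2
    have hid : ∀ a a' b b' : C, a' * b' - a * b = a' * (b' - b) + (a' - a) * b := by intros; ring
    rw [hid]
    exact Ideal.add_mem _ h h2

variable {Q : MvPolynomial σ k}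

theorem MvPolynomial.aeval_mem_pow_three (hQ : ∀ m : σ →₀ ℕ, m.degree < 3 → Q.coeff m = 0)
    {c : σ → C} (hc : ∀ i, c i ∈ I) :
    MvPolynomial.aeval c Q ∈ I ^ 3 := by
  rw [MvPolynomial.aeval_def, MvPolynomial.eval₂_eq]
  refine sum_mem fun m hm => Ideal.mul_mem_left _ _ ?_
  have : 3 ≤ m.degree := by
    by_contra! h
    exact MvPolynomial.mem_support_iff.1 hm (hQ m h)
  exact Ideal.pow_le_pow_right this (Finsupp.prod_pow_mem hc m)

theorem MvPolynomial.aeval_sub_mem (hQ : ∀ m : σ →₀ ℕ, m.degree < 3 → Q.coeff m = 0)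
    {c c' : σ → C} (hc : ∀ i, c i ∈ I) {e : ℕ} (he : 1 ≤ e) (hcc : ∀ i, c' i - c i ∈ I ^ e) :
    MvPolynomial.aeval c' Q - MvPolynomial.aeval c Q ∈ I ^ (e + 2) := by
  rw [MvPolynomial.aeval_def, MvPolynomial.aeval_def, MvPolynomial.eval₂_eq,
    MvPolynomial.eval₂_eq, ← Finset.sum_sub_distrib]
  refine sum_mem fun m hm => ?_
  rw [← mul_sub]
  have : 3 ≤ m.degree := by
    by_contra! h
    exact MvPolynomial.mem_support_iff.1 hm (hQ m h)
  exact Ideal.mul_mem_left _ _ (Finsupp.prod_pow_sub_mem hc he hcc m 2 this)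

/-- Morse lemma: modulo any power of the ideal generated by the `y i`, the polynomial
`∑ X i ^ 2 + Q` takes the value `∑ y i ^ 2` at a point congruent to `y` to first order. -/
theorem exists_morse_coordinates [Fintype σ]
    (hQ : ∀ m : σ →₀ ℕ, m.degree < 3 → Q.coeff m = 0) {h : C} (h2 : 2 * h = 1) (y : σ → C)
    (hI : I = Ideal.span (Set.range y)) (d : ℕ) :
    ∃ c : σ → C, (∀ i, c i - y i ∈ I ^ 2) ∧
      MvPolynomial.aeval c (∑ i, (MvPolynomial.X i : MvPolynomial σ k) ^ 2 + Q) - ∑ i, y i ^ 2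
        ∈ I ^ (d + 3) := by
  have hy : ∀ i, y i ∈ I := fun i => hI ▸ Ideal.subset_span ⟨i, rfl⟩
  simp only [map_add, map_sum, map_pow, MvPolynomial.aeval_X]
  induction d with
  | zero => exact ⟨y, by simp, by simpa using MvPolynomial.aeval_mem_pow_three hQ hy⟩
  | succ d ih =>
    obtain ⟨c, hc, hr⟩ := ih
    have hcI : ∀ i, c i ∈ I := fun i => by
      simpa using I.add_mem (Ideal.pow_le_self two_ne_zero (hc i)) (hy i)
    -- Newton iteration: the error lies in `I ^ (d + 2) * I`, so it is `∑ a i * y i`. Replacing `c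
    -- i` by `c i - a i / 2` cancels it, since `c i ≡ y i` modulo `I ^ 2`.
    obtain ⟨a, ha, hsum⟩ : ∃ a : σ → C, (∀ i, a i ∈ I ^ (d + 2)) ∧
        ∑ i, a i * y i = ∑ i, c i ^ 2 + MvPolynomial.aeval c Q - ∑ i, y i ^ 2 := by
      have h1 : ∑ i, c i ^ 2 + MvPolynomial.aeval c Q - ∑ i, y i ^ 2 ∈
          I ^ (d + 2) • Submodule.span C (Set.range y) := by
        rw [show d + 3 = d + 2 + 1 from rfl, pow_succ] at hr
        exact (congrArg (I ^ (d + 2) * ·) hI).le hr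
      rw [Submodule.mem_ideal_smul_span_iff_exists_sum] at h1
      obtain ⟨a, ha, h1⟩ := h1
      refine ⟨a, ha, ?_⟩
      rw [← h1, Finsupp.sum_fintype _ _ (by simp)]
      simp
    have hcc : ∀ i, (c i - h * a i) - c i ∈ I ^ (d + 2) := fun i => by
      have := (I ^ (d + 2)).neg_mem (Ideal.mul_mem_left _ h (ha i))
      convert this using 1; ring
    refine ⟨fun i => c i - h * a i, fun i => ?_, ?_⟩
    · have := (I ^ 2).add_mem (hc i) (Ideal.pow_le_pow_right (show 2 ≤ d + 2 by omega) (hcc i))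
      convert this using 1; ring
    · have h1 := MvPolynomial.aeval_sub_mem hQ hcI (show 1 ≤ d + 2 by omega) hcc
      have h3 : ∀ i, h ^ 2 * (a i * a i) - (c i - y i) * a i ∈ I ^ (d + 2 + 2) := fun i => by
        refine Ideal.sub_mem _ (Ideal.mul_mem_left _ _ ?_) ?_
        · have := Ideal.mul_mem_mul (ha i) (ha i)
          rw [← pow_add] at this
          exact Ideal.pow_le_pow_right (by omega) this
        · have := Ideal.mul_mem_mul (hc i) (ha i)
          rwa [← pow_add, add_comm] at this
      have h4 := Ideal.add_mem _ h1 (Ideal.sum_mem (t := Finset.univ) _ fun i _ => h3 i)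
      convert h4 using 1
      have h5 : ∀ i, (c i - h * a i) ^ 2 =
          c i ^ 2 - a i * y i + (h ^ 2 * (a i * a i) - (c i - y i) * a i) := fun i => by
        linear_combination (-c i * a i) * h2
      simp only [h5, Finset.sum_add_distrib, Finset.sum_sub_distrib] at *
      rw [hsum]
      ring

end

/-! ### The equation forced in `W₂(C)` -/

section

variable {p : ℕ} [hp : Fact p.Prime] {k C B A σ : Type*} [Field k] [CommRing C] [CharP C p]
  [CommRing B] [CommRing A] [Fintype σ]

/-- The identity in `W₂(C)` forced by a lift `A` of `B` with a lift of Frobenius. -/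
theorem exists_sum_teich_sq_eq {I : Ideal C} (hI : I ^ (2 * p + 1) = ⊥)
    (hIp : ∀ a ∈ I, a ^ p = 0) {Q : MvPolynomial σ k}
    (hQ : ∀ m : σ →₀ ℕ, m.degree < 3 → Q.coeff m = 0)
    (φ : A →+* A) (hφ : ∀ a, ∃ d, φ a = a ^ p + p * d)
    (htors : ∀ a : A, (p : A) * a = 0 → ∃ b, a = p * b)
    (r : A →+* B) (hr : Function.Surjective r) (hker : ∀ a, r a = 0 → ∃ b, a = p * b)
    (θ : MvPolynomial σ k →+* B) (hθ : θ (∑ i, MvPolynomial.X i ^ 2 + Q) = 0)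
    (s : B →+* C) (y : σ → C) (hy : ∀ i, y i ∈ I)
    (hsy : ∀ i, s (θ (MvPolynomial.X i)) - y i ∈ I ^ 2)
    (hsum : ∑ i, y i ^ 2 = 0) :
    ∃ γ : C, ∑ i, teich p (y i ^ 2) = wittV p (γ ^ p) := by
  classical
  set c : σ → C := fun i => s (θ (MvPolynomial.X i)) with hcdef
  have hcI : ∀ i, c i ∈ I := fun i => by
    simpa using I.add_mem (Ideal.pow_le_self two_ne_zero (hsy i)) (hy i)
  obtain ⟨ψ, hψ⟩ := exists_ringHom_wittTwo (p := p) (s.comp r) (fun a ha => by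
    obtain ⟨b, rfl⟩ := htors a ha
    simp) φ hφ
  choose x hx using fun i => hr (θ (MvPolynomial.X i))
  choose α hα using fun m => hr (θ (MvPolynomial.C (Q.coeff m)))
  have hQsum : Q = ∑ m ∈ Q.support, MvPolynomial.C (Q.coeff m) *
      m.prod fun i e => (MvPolynomial.X i : MvPolynomial σ k) ^ e := by
    conv_lhs => rw [Q.as_sum]
    exact Finset.sum_congr rfl fun m _ => MvPolynomial.monomial_eq
  -- Arbitrary lifts of the variables and coefficients satisfy the equation up to a multiple of `p`;
  -- the image of `g` in `C` will be `γ`.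
  obtain ⟨g, hg⟩ : ∃ g, ∑ i, x i ^ 2 + ∑ m ∈ Q.support, α m * m.prod (fun i e => x i ^ e) =
      p * g := by
    refine hker _ ?_
    rw [← hθ]
    conv_rhs => rw [hQsum]
    simp [hx, hα]
  have hξ : ∀ i, (ψ (x i)).coeff 0 = c i := fun i => by rw [hψ]; simp [hx, hcdef]
  have hξp : ∀ i, (ψ (x i)).coeff 0 ^ p = 0 := fun i => by rw [hξ]; exact hIp _ (hcI i)
  have h1 := congrArg ψ hg
  rw [map_add, map_sum, map_sum, map_mul, map_natCast, mul_comm (p : WittTwo p C),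
    mul_natCast_eq_wittV] at h1
  have hmem1 : ∀ i ∈ Finset.univ, c i ^ 2 - y i ^ 2 ∈ I ^ 3 := fun i _ => by
    have := Ideal.mul_mem_mul (hsy i) (I.add_mem (hcI i) (hy i))
    rw [← pow_succ] at this
    convert this using 1
    ring
  have h2 : ∀ i, ψ (x i ^ 2) = teich p (y i ^ 2) + teich p (c i ^ 2 - y i ^ 2) := fun i => by
    rw [map_pow, sq, mul_eq_teich (hξp i) (hξp i), hξ, ← sq, ← teich_add_of_mem hI
      (Ideal.pow_mem_pow (hy i) 2)]
    · rw [add_sub_cancel]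
    · exact hmem1 i (Finset.mem_univ i)
  have hdeg : ∀ m ∈ Q.support, 3 ≤ m.degree := fun m hm => by
    by_contra! h
    exact MvPolynomial.mem_support_iff.1 hm (hQ m h)
  have h3 : ∀ m ∈ Q.support, ψ (α m * m.prod (fun i e => x i ^ e)) =
      teich p (s (θ (MvPolynomial.C (Q.coeff m))) * m.prod fun i e => c i ^ e) := fun m hm => by
    rw [map_mul, map_finsuppProd]
    simp only [map_pow]
    rw [prod_eq_teich _ hξp _ ((hdeg m hm).trans' (by norm_num))]
    simp only [hξ]
    rw [mul_teich_eq, hψ]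
    · simp [hα]
    · exact hIp _ (Ideal.pow_le_self (by have := hdeg m hm; omega) (Finsupp.prod_pow_mem hcI m))
  have hmem2 : ∀ m ∈ Q.support, s (θ (MvPolynomial.C (Q.coeff m))) *
      m.prod (fun i e => c i ^ e) ∈ I ^ 3 := fun m hm =>
    Ideal.mul_mem_left _ _ (Ideal.pow_le_pow_right (hdeg m hm) (Finsupp.prod_pow_mem hcI m))
  -- All terms of order at least three have sum zero in `C`. Their Teichmüller representatives add
  -- without carry, so they also contribute zero in `W₂(C)`.
  have h4 : ∑ i, (c i ^ 2 - y i ^ 2) + ∑ m ∈ Q.support,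
      s (θ (MvPolynomial.C (Q.coeff m))) * m.prod (fun i e => c i ^ e) = 0 := by
    have h4 := congrArg s hθ
    conv_lhs at h4 => rw [hQsum]
    rw [Finset.sum_sub_distrib, hsum, sub_zero]
    simpa [map_finsuppProd] using h4
  rw [Finset.sum_congr rfl fun i _ => h2 i, Finset.sum_congr rfl h3, Finset.sum_add_distrib,
    ← teich_sum_of_mem hI _ _ hmem1, ← teich_sum_of_mem hI _ _ hmem2, add_assoc,
    ← teich_add_of_mem hI (Ideal.pow_le_pow_right (by norm_num) (sum_mem hmem1)) (sum_mem hmem2),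
    h4, teich_zero, add_zero] at h1
  exact ⟨_, h1⟩

end

/-! ### Evaluating the carry on a quadric -/

section

variable {p : ℕ} [hp : Fact p.Prime] {C : Type*} [CommRing C]

/-- Only the term linear in `b` survives, and its coefficient is `p / p = 1`. -/
theorem wittCarry_eq_of_sq_eq_zero {a b : C} (hb : b ^ 2 = 0) :
    wittCarry p a b = -(a ^ (p - 1) * b) := by
  have h2 := hp.out.two_le
  rw [wittCarry, Finset.sum_eq_single_of_mem (p - 1) (by rw [Finset.mem_Ioo]; omega)]
  · have : p.choose (p - 1) = p := by
      rw [Nat.choose_symm_of_eq_add (show p = p - 1 + 1 by omega), Nat.choose_one_right]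
    rw [this, Nat.div_self hp.out.pos, show p - (p - 1) = 1 by omega]
    simp
  · intro i hi hne
    rw [Finset.mem_Ioo] at hi
    obtain ⟨e, he⟩ := Nat.exists_eq_add_of_le (show 2 ≤ p - i by omega)
    rw [he, pow_add, hb, zero_mul, mul_zero, mul_zero]

/-- Substituting `b = -(a + t²)` turns the sum into `[a] + [t²] - [a + t²]`, which is exactly `V` of
the carry. -/
theorem pow_eq_of_teich_sum_eq (hp2 : p ≠ 2) {a b t γ : C} (ht : t ^ 4 = 0)
    (hrel : a + b + t ^ 2 = 0)
    (h : teich p a + teich p b + teich p (t ^ 2) = wittV p (γ ^ p)) :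
    γ ^ p = -(a ^ (p - 1) * t ^ 2) := by
  have hb : b = -(a + t ^ 2) := by linear_combination hrel
  rw [hb, teich_neg hp2, add_right_comm, teich_add_teich, wittCarry_eq_of_sq_eq_zero
    (by rw [← pow_mul, ht])] at h
  apply wittV_injective (p := p)
  rw [← h]
  ring

variable [CharP C p]

theorem add_pow_eq_zero_of_pow_eq_zero {a b : C} (ha : a ^ p = 0) (hb : b ^ p = 0) :
    (a + b) ^ p = 0 := by
  rw [add_pow_char, ha, hb, add_zero]

/-- The identity `((u + v) / 2) ^ 2 - ((u - v) / 2) ^ 2 = uv` persists for Teichmüller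
representatives, because each expansion is carry-free when a factor has zero `p`-th power. -/
theorem teich_hyperbolic (hp2 : p ≠ 2) {h j u v : C} (h2 : 2 * h = 1) (hj : j ^ 2 = -1)
    (hu : u ^ p = 0) (hv : v ^ p = 0) :
    teich p ((h * (u + v)) ^ 2) + teich p ((h * j * (u - v)) ^ 2) = teich p (u * v) := by
  have hmul : ∀ {a : C} (x : C), a ^ p = 0 → (x * a) ^ p = 0 := fun x ha => by
    rw [mul_pow, ha, mul_zero]
  have hnv : (-v) ^ p = 0 := by rw [(hp.out.odd_of_ne_two hp2).neg_pow, hv, neg_zero]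
  have e1 : ∀ {v : C}, v ^ p = 0 → teich p (h ^ 2 * (u + v) ^ 2) =
      teich p (h ^ 2 * u ^ 2) + teich p (h ^ 2 * (u * v)) +
        (teich p (h ^ 2 * (u * v)) + teich p (h ^ 2 * v ^ 2)) := by
    intro v hv
    rw [show h ^ 2 * (u + v) ^ 2 = (u + v) * (h ^ 2 * (u + v)) by ring,
      teich_add_mul (hmul _ (add_pow_eq_zero_of_pow_eq_zero hu hv)),
      show u * (h ^ 2 * (u + v)) = (u + v) * (h ^ 2 * u) by ring,
      show v * (h ^ 2 * (u + v)) = (u + v) * (h ^ 2 * v) by ring,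
      teich_add_mul (hmul _ hu), teich_add_mul (hmul _ hv)]
    congr 2 <;> congr 1 <;> ring
  rw [show (h * (u + v)) ^ 2 = h ^ 2 * (u + v) ^ 2 by ring,
    show (h * j * (u - v)) ^ 2 = -(h ^ 2 * (u + -v) ^ 2) by
      linear_combination (h ^ 2 * (u - v) ^ 2) * hj, teich_neg hp2, e1 hv, e1 hnv]
  -- The integer `4` is not `[4]` in general, but multiplication by `[v]` sees only its zeroth
  -- coordinate.
  have e2 : teich p (u * v) = 4 * teich p (h ^ 2 * (u * v)) := by
    rw [← mul_assoc (h ^ 2), map_mul (teich p) (h ^ 2 * u), ← mul_assoc, mul_teich_eq hv,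
      wittTwo_mul_coeff_zero, teich_coeff_zero]
    have : (4 : WittTwo p C).coeff 0 = 4 := map_ofNat (wittTwoResidue p C) 4
    rw [this]
    congr 1
    linear_combination (-2 * h - 1) * u * v * h2
  rw [e2, mul_neg, mul_neg, teich_neg hp2, neg_sq]
  ring

end

/-! ### Passing between squares and hyperbolic coordinates -/

section

variable {C : Type*} [CommRing C]

/-- A point of a sum of squares in at least five variables. -/
def quadricPoint (n : ℕ) (h j u v w z t : C) : Fin (n + 5) → C :=
  Fin.cons (h * (u + v)) <| Fin.cons (h * j * (u - v)) <| Fin.cons (h * (w + z)) <|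
    Fin.cons (h * j * (w - z)) <| Fin.cons t fun _ => 0

theorem sum_quadricPoint {M : Type*} [AddCommMonoid M] (f : C → M) (hf : f 0 = 0) (n : ℕ)
    (h j u v w z t : C) :
    ∑ i, f (quadricPoint n h j u v w z t i) = f (h * (u + v)) + (f (h * j * (u - v)) +
      (f (h * (w + z)) + (f (h * j * (w - z)) + f t))) := by
  simp [quadricPoint, Fin.sum_univ_succ, hf]

theorem span_range_quadricPoint (n : ℕ) {h j u v w z t : C} (h2 : 2 * h = 1) (hj : j ^ 2 = -1) :
    Ideal.span {u, v, w, z, t} = Ideal.span (Set.range (quadricPoint n h j u v w z t)) := by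
  apply le_antisymm
  · rw [Ideal.span_le]
    set I := Ideal.span (Set.range (quadricPoint n h j u v w z t))
    have hmem : ∀ i, quadricPoint n h j u v w z t i ∈ I := fun i => Ideal.subset_span ⟨i, rfl⟩
    have m0 : h * (u + v) ∈ I := hmem 0
    have m1 : h * j * (u - v) ∈ I := hmem (Fin.succ 0)
    have m2 : h * (w + z) ∈ I := hmem (Fin.succ (Fin.succ 0))
    have m3 : h * j * (w - z) ∈ I := hmem (Fin.succ (Fin.succ (Fin.succ 0)))
    have m4 : t ∈ I := hmem (Fin.succ (Fin.succ (Fin.succ (Fin.succ 0))))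
    have key : ∀ {a b : C}, h * (a + b) ∈ I → h * j * (a - b) ∈ I → a ∈ I ∧ b ∈ I := by
      intro a b ha hb
      have hb' := I.mul_mem_left (-j) hb
      constructor
      · convert I.add_mem ha hb' using 1
        linear_combination (-a) * h2 + h * (a - b) * hj
      · convert I.sub_mem ha hb' using 1
        linear_combination (-b) * h2 - h * (a - b) * hj
    rintro x (rfl | rfl | rfl | rfl | rfl)
    exacts [(key m0 m1).1, (key m0 m1).2, (key m2 m3).1, (key m2 m3).2, m4]
  · rw [Ideal.span_le]
    set I := Ideal.span {u, v, w, z, t}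
    have hu : u ∈ I := Ideal.subset_span (by simp)
    have hv : v ∈ I := Ideal.subset_span (by simp)
    have hw : w ∈ I := Ideal.subset_span (by simp)
    have hz : z ∈ I := Ideal.subset_span (by simp)
    have ht : t ∈ I := Ideal.subset_span (by simp)
    rintro _ ⟨i, rfl⟩
    refine Fin.cases ?_ (fun i => Fin.cases ?_ (fun i => Fin.cases ?_ (fun i => Fin.cases ?_
      (fun i => Fin.cases ?_ (fun i => ?_) i) i) i) i) i
    · exact I.mul_mem_left _ (I.add_mem hu hv)
    · exact I.mul_mem_left _ (I.sub_mem hu hv)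
    · exact I.mul_mem_left _ (I.add_mem hw hz)
    · exact I.mul_mem_left _ (I.sub_mem hw hz)
    · exact ht
    · exact I.zero_mem

end

/-! ### The Artinian test ring -/

section

/-- Coefficients of a linear functional on polynomials in five variables which, on the quotient by
`X₀ X₁ + X₂ X₃ + X₄ ^ 2` and the `p`-th powers, detects `(X₀ X₁) ^ (p - 1) X₄ ^ 2`. -/
def socleCoeff (p : ℕ) (K : Type*) [CommRing K] (m : Fin 5 →₀ ℕ) : K :=
  if m 0 = m 1 ∧ m 2 = m 3 ∧ m 4 = 0 ∧ m 0 + m 2 = p then (-1) ^ m 2 * m 2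
  else if m 0 = m 1 ∧ m 2 = m 3 ∧ m 4 = 2 ∧ m 0 + m 2 + 1 = p then (-1) ^ m 2 else 0

/-- The linear functional with coefficients `socleCoeff`. -/
noncomputable def socleFunctional (p : ℕ) (K : Type*) [Field K] :
    MvPolynomial (Fin 5) K →ₗ[K] K :=
  (MvPolynomial.basisMonomials (Fin 5) K).constr K (socleCoeff p K)

variable (p : ℕ) (K : Type*) [Field K]

theorem socleFunctional_monomial (m : Fin 5 →₀ ℕ) (a : K) :
    socleFunctional p K (MvPolynomial.monomial m a) = a * socleCoeff p K m := by
  have h : MvPolynomial.monomial m a = a • MvPolynomial.basisMonomials (Fin 5) K m := by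
    simp [MvPolynomial.smul_monomial]
  rw [h, map_smul, socleFunctional, Module.Basis.constr_basis, smul_eq_mul]

/-- The largest ideal contained in the kernel of `socleFunctional`. -/
noncomputable def socleIdeal : Ideal (MvPolynomial (Fin 5) K) where
  carrier := {s | ∀ r, socleFunctional p K (s * r) = 0}
  add_mem' ha hb r := by rw [add_mul, map_add, ha, hb, add_zero]
  zero_mem' r := by rw [zero_mul, map_zero]
  smul_mem' c s hs r := by
    rw [smul_eq_mul, mul_comm c, mul_assoc]; exact hs _

theorem mem_socleIdeal {s : MvPolynomial (Fin 5) K}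
    (h : ∀ m, socleFunctional p K (s * MvPolynomial.monomial m 1) = 0) : s ∈ socleIdeal p K := by
  have : (socleFunctional p K).comp (LinearMap.mulLeft K s) = 0 := by
    refine (MvPolynomial.basisMonomials (Fin 5) K).ext fun m => ?_
    simpa using h m
  exact fun r => LinearMap.congr_fun this r

theorem monomial_mem_socleIdeal {m : Fin 5 →₀ ℕ}
    (h : ∀ m', socleCoeff p K (m + m') = 0) : MvPolynomial.monomial m 1 ∈ socleIdeal p K :=
  mem_socleIdeal p K fun m' => by
    rw [MvPolynomial.monomial_mul, socleFunctional_monomial, h, mul_zero]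

/-- With `a + c = p - 1` the critical cancellation is `(-1)^c c + (-1)^(c+1) (c + 1) + (-1)^c = 0`;
for the monomials containing `X₄ ^ 2` the signs alternate. -/
theorem quadric_mem_socleIdeal :
    (MvPolynomial.X 0 * MvPolynomial.X 1 + MvPolynomial.X 2 * MvPolynomial.X 3 +
      MvPolynomial.X 4 ^ 2 : MvPolynomial (Fin 5) K) ∈ socleIdeal p K := by
  refine mem_socleIdeal p K fun m => ?_
  simp only [MvPolynomial.X, MvPolynomial.monomial_pow, MvPolynomial.monomial_mul, add_mul,
    map_add, socleFunctional_monomial, one_pow, mul_one, one_mul]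
  simp only [socleCoeff, Finsupp.add_apply, Finsupp.smul_apply, Finsupp.single_apply]
  simp only [Fin.isValue, Fin.reduceEq, if_true, if_false, smul_eq_mul, mul_one, mul_zero,
    add_zero, zero_add]
  generalize m 0 = a, m 1 = b, m 2 = c, m 3 = d, m 4 = e
  by_cases hab : a = b
  · by_cases hcd : c = d
    · subst hab hcd
      by_cases he : e = 0
      · subst he
        by_cases hs : a + c + 1 = p
        · simp [show 1 + a + c = p by omega, show a + (1 + c) = p by omega, hs, pow_add]
          ring
        · simp [show 1 + a + c ≠ p by omega, show a + (1 + c) ≠ p by omega, hs]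
      · by_cases he2 : e = 2
        · subst he2
          by_cases hs : a + c + 2 = p
          · simp [show 1 + a + c + 1 = p by omega, show a + (1 + c) + 1 = p by omega, pow_add]
          · simp [show 1 + a + c + 1 ≠ p by omega, show a + (1 + c) + 1 ≠ p by omega]
        · simp [he, he2]
    · simp [hcd]
  · simp [hab]

/-- The functional is supported in degree exactly `2p`. -/
theorem mem_socleIdeal_of_degree {s : MvPolynomial (Fin 5) K}
    (hs : s ∈ (Ideal.span (Set.range MvPolynomial.X)) ^ (2 * p + 1)) : s ∈ socleIdeal p K := by
  have h0 : ∀ s ∈ (Ideal.span (Set.range MvPolynomial.X) : Ideal (MvPolynomial (Fin 5) K))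
      ^ (2 * p + 1), socleFunctional p K s = 0 := by
    intro s hs
    have hs' : s ∈ MvPolynomial.idealOfVars (Fin 5) K ^ (2 * p + 1) := hs
    rw [MvPolynomial.mem_pow_idealOfVars_iff] at hs'
    rw [s.as_sum, map_sum]
    refine Finset.sum_eq_zero fun m hm => ?_
    have hd := hs' m hm
    rw [socleFunctional_monomial]
    have : m.degree = m 0 + m 1 + m 2 + m 3 + m 4 := by
      rw [Finsupp.degree_eq_sum]; simp [Fin.sum_univ_succ]; ring
    rw [socleCoeff, if_neg (by omega), if_neg (by omega), mul_zero]
  exact fun r => h0 _ (Ideal.mul_mem_right _ _ hs)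

end


/-- An Artinian ring containing a point of the quadric cone `uv + wz + t² = 0` at which the
Witt vector carry does not vanish. -/
theorem exists_quadric_test_ring {p : ℕ} (hp : 3 ≤ p) (K : Type u) [Field K] [CharP K p] :
    ∃ (C : Type u) (_ : CommRing C) (_ : Algebra K C) (u v w z t : C),
      Ideal.span {u, v, w, z, t} ^ (2 * p + 1) = ⊥ ∧ u ^ p = 0 ∧ v ^ p = 0 ∧ w ^ p = 0 ∧
      z ^ p = 0 ∧ t ^ 3 = 0 ∧ u * v + w * z + t ^ 2 = 0 ∧ (u * v) ^ (p - 1) * t ^ 2 ≠ 0 ∧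
      ∀ a : C, ∃ κ : K, a - algebraMap K C κ ∈ Ideal.span {u, v, w, z, t} := by
  let π : MvPolynomial (Fin 5) K →ₐ[K] _ := Ideal.Quotient.mkₐ K (socleIdeal p K)
  have hπ : ∀ {s}, s ∈ socleIdeal p K → π s = 0 := Ideal.Quotient.eq_zero_iff_mem.2
  have hspan : Ideal.span {π (.X 0), π (.X 1), π (.X 2), π (.X 3), π (.X 4)} =
      Ideal.map π (Ideal.span (Set.range MvPolynomial.X)) := by
    rw [Ideal.map_span, ← Set.range_comp]
    congr 1
    ext x
    simp [Fin.exists_fin_succ, eq_comm]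
  have hX : ∀ (i : Fin 5) (e : ℕ), (∀ m', socleCoeff p K (Finsupp.single i e + m') = 0) →
      π (.X i) ^ e = 0 := fun i e h => by
    rw [← map_pow, MvPolynomial.X_pow_eq_monomial]
    exact hπ (monomial_mem_socleIdeal p K h)
  refine ⟨_, inferInstance, inferInstance, π (.X 0), π (.X 1), π (.X 2), π (.X 3), π (.X 4),
    ?_, hX _ _ fun m => ?_, hX _ _ fun m => ?_, hX _ _ fun m => ?_, hX _ _ fun m => ?_,
    hX _ _ fun m => ?_, ?_, ?_, ?_⟩
  · rw [hspan, ← Ideal.map_pow, eq_bot_iff, Ideal.map_le_iff_le_comap]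
    exact fun s hs => hπ (mem_socleIdeal_of_degree p K hs)
  · simp only [socleCoeff, Finsupp.add_apply, Finsupp.single_apply]
    simp only [Fin.isValue, Fin.reduceEq, if_true, if_false, zero_add]
    split_ifs with h1 h2
    · simp [show m 2 = 0 by omega]
    · omega
    · rfl
  · simp only [socleCoeff, Finsupp.add_apply, Finsupp.single_apply]
    simp only [Fin.isValue, Fin.reduceEq, if_true, if_false, zero_add]
    split_ifs with h1 h2
    · simp [show m 2 = 0 by omega]
    · omega
    · rfl
  -- For `w ^ p` and `z ^ p` the remaining coefficient is `(-1) ^ p * p`, which vanishes because `K`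
  -- has characteristic `p`.
  · simp only [socleCoeff, Finsupp.add_apply, Finsupp.single_apply]
    simp only [Fin.isValue, Fin.reduceEq, if_true, if_false, zero_add]
    split_ifs with h1 h2
    · simp [show m 2 = 0 by omega]
    · omega
    · rfl
  · simp only [socleCoeff, Finsupp.add_apply, Finsupp.single_apply]
    simp only [Fin.isValue, Fin.reduceEq, if_true, if_false, zero_add]
    split_ifs with h1 h2
    · rw [show m 2 = p by omega]; simp
    · omega
    · rfl
  · simp only [socleCoeff, Finsupp.add_apply, Finsupp.single_apply]
    simp only [Fin.isValue, Fin.reduceEq, if_true, if_false, zero_add]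
    rw [if_neg (by omega), if_neg (by omega)]
  · have := hπ (quadric_mem_socleIdeal p K)
    simpa using this
  · intro h
    have h1 : ((MvPolynomial.X 0 * MvPolynomial.X 1) ^ (p - 1) * MvPolynomial.X 4 ^ 2 :
        MvPolynomial (Fin 5) K) ∈ socleIdeal p K := by
      refine Ideal.Quotient.eq_zero_iff_mem.1 (Eq.trans ?_ h)
      change π _ = _
      simp
    have h2 := h1 1
    simp only [MvPolynomial.X, MvPolynomial.monomial_pow, MvPolynomial.monomial_mul, mul_one,
      socleFunctional_monomial, one_pow, one_mul] at h2
    simp only [socleCoeff, Finsupp.add_apply, Finsupp.smul_apply, Finsupp.single_apply] at h2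
    simp only [Fin.isValue, Fin.reduceEq, if_true, if_false, smul_eq_mul, mul_one, mul_zero,
      add_zero, zero_add] at h2
    simp [show p - 1 + 1 = p by omega] at h2
  · intro a
    obtain ⟨s, rfl⟩ : ∃ s, π s = a := Ideal.Quotient.mk_surjective a
    refine ⟨MvPolynomial.constantCoeff s, ?_⟩
    rw [hspan, ← AlgHom.commutes π, ← map_sub]
    refine Ideal.mem_map_of_mem _ ?_
    change _ ∈ MvPolynomial.idealOfVars (Fin 5) K
    rw [← pow_one (MvPolynomial.idealOfVars (Fin 5) K), MvPolynomial.mem_pow_idealOfVars_iff]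
    intro m hm
    by_contra! hlt
    rw [Nat.lt_one_iff, Finsupp.degree_eq_zero_iff] at hlt
    subst hlt
    refine MvPolynomial.mem_support_iff.1 hm ?_
    simp [MvPolynomial.algebraMap_eq, MvPolynomial.constantCoeff_eq]

/-! ### From the flat lifting to commutative algebra -/

theorem wittTwo_mul_natCast_eq_zero {p : ℕ} [hp : Fact p.Prime] {k : Type*} [Field k]
    [CharP k p] {x : WittTwo p k} (h : (p : WittTwo p k) * x = 0) :
    x.coeff 0 = 0 := by
  rw [mul_comm, mul_natCast_eq_wittV] at h
  have := congrArg (fun x => TruncatedWittVector.coeff 1 x) h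
  simpa [hp.out.ne_zero] using this

/-- Perfectness gives `V(b ^ p) = p [b]` with `b ^ p` arbitrary, so the kernel of reduction is
generated by `p`. -/
theorem wittTwo_eq_natCast_mul {p : ℕ} [hp : Fact p.Prime] {k : Type*} [Field k]
    [CharP k p] [PerfectField k] {x : WittTwo p k} (h : x.coeff 0 = 0) :
    ∃ y, x = p * y := by
  have := PerfectField.toPerfectRing (K := k) p
  obtain ⟨b, hb⟩ := surjective_frobenius k p (x.coeff 1)
  refine ⟨teich p b, ?_⟩
  rw [mul_comm, mul_natCast_eq_wittV, eq_teich_add_wittV x, h, teich_zero, zero_add, ← hb,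
    teich_coeff_zero]
  rfl

/-- By the equational criterion the relation `p • a = 0` comes from relations in `W`, where the
annihilator of `p` lies in `pW`. -/
theorem Module.Flat.exists_eq_smul {W M : Type*} [CommRing W] [AddCommGroup M] [Module W M]
    [Module.Flat W M] (p : W) (hW : ∀ x : W, p * x = 0 → ∃ y, x = p * y) {a : M}
    (ha : p • a = 0) : ∃ b : M, a = p • b := by
  have h : ∑ i : Unit, (fun _ => p) i • (fun _ => a) i = 0 := by simpa using ha
  obtain ⟨l, c, y, h1, h2⟩ := Module.Flat.isTrivialRelation_of_sum_smul_eq_zero h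
  have h3 : ∀ j, ∃ d, c () j = p * d := fun j => hW (c () j) (by simpa using h2 j)
  choose d hd using h3
  refine ⟨∑ j, d j • y j, (h1 ()).trans ?_⟩
  rw [Finset.smul_sum]
  exact Finset.sum_congr rfl fun j _ => by rw [hd, mul_smul]

theorem RingHom.Flat.exists_eq_natCast_mul {W A : Type*} [CommRing W] [CommRing A] {f : W →+* A}
    (hf : f.Flat) (p : ℕ) (hW : ∀ x : W, (p : W) * x = 0 → ∃ y, x = p * y) {a : A}
    (ha : (p : A) * a = 0) : ∃ b, a = p * b := by
  let _ : Algebra W A := f.toAlgebra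
  have _ : Module.Flat W A := hf
  have hsmul : ∀ b : A, (p : W) • b = p * b := fun b => by rw [Algebra.smul_def, map_natCast]
  obtain ⟨b, hb⟩ := Module.Flat.exists_eq_smul (p : W) hW ((hsmul a).trans ha)
  exact ⟨b, hb.trans (hsmul b)⟩


/-- Since `k = W / p`, the pushout is `A / p`; the inverse maps come from the two universal
properties. -/
theorem CommRingCat.surjective_of_isPushout_of_surjective {W A k B : CommRingCat.{u}} {f : W ⟶ A}
    {g : W ⟶ k} {r : A ⟶ B} {l : k ⟶ B} (h : IsPushout f g r l) (hg : Function.Surjective g.hom)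
    (p : ℕ) (hp : (p : k) = 0) (hker : ∀ x, g.hom x = 0 → ∃ y, x = p * y) :
    Function.Surjective r.hom ∧ ∀ a, r.hom a = 0 → ∃ b, a = p * b := by
  let J : Ideal A := Ideal.span {(p : A)}
  have hmk : ∀ a, Ideal.Quotient.mk J a = 0 → ∃ b, a = p * b := fun a ha => by
    rw [Ideal.Quotient.eq_zero_iff_mem, Ideal.mem_span_singleton] at ha
    exact ha
  let l' : k →+* A ⧸ J := g.hom.liftOfRightInverse _ (Function.rightInverse_surjInv hg)
    ⟨(Ideal.Quotient.mk J).comp f.hom, fun x hx => by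
      obtain ⟨y, rfl⟩ := hker x hx
      rw [RingHom.mem_ker, RingHom.comp_apply, Ideal.Quotient.eq_zero_iff_mem, map_mul, map_natCast]
      exact Ideal.mul_mem_right _ _ (Ideal.mem_span_singleton_self _)⟩
  have hl' : ∀ x, l' (g.hom x) = Ideal.Quotient.mk J (f.hom x) := fun x =>
    RingHom.liftOfRightInverse_comp_apply _ _ _ _ x
  let q : A ⟶ CommRingCat.of (A ⧸ J) := CommRingCat.ofHom (Ideal.Quotient.mk J)
  have hw : f ≫ q = g ≫ CommRingCat.ofHom l' := by
    ext x
    exact (hl' x).symm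
  let d : B ⟶ CommRingCat.of (A ⧸ J) := h.desc q (CommRingCat.ofHom l') hw
  have hd : r ≫ d = q := h.inl_desc _ _ _
  have hd2 : l ≫ d = CommRingCat.ofHom l' := h.inr_desc _ _ _
  let e : CommRingCat.of (A ⧸ J) ⟶ B := CommRingCat.ofHom (Ideal.Quotient.lift J r.hom (by
    intro a ha
    obtain ⟨b, rfl⟩ := hmk a (Ideal.Quotient.eq_zero_iff_mem.2 ha)
    have h0 : (p : B) = 0 := by rw [← map_natCast l.hom, hp, map_zero]
    rw [map_mul, map_natCast, h0, zero_mul]))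
  have hqe : q ≫ e = r := by
    ext a
    rfl
  have hid : d ≫ e = 𝟙 B := by
    refine h.hom_ext ?_ ?_
    · rw [← Category.assoc, hd, hqe, Category.comp_id]
    · rw [← Category.assoc, hd2, Category.comp_id]
      ext y
      obtain ⟨x, rfl⟩ := hg y
      have h2 := congrArg (fun t => t.hom (f.hom x)) hqe
      have h3 := congrArg (fun t => t.hom x) h.w
      change e.hom (l' (g.hom x)) = l.hom (g.hom x)
      rw [hl']
      exact h2.trans h3
  refine ⟨fun b => ?_, fun a ha => hmk a ?_⟩
  · obtain ⟨a, ha⟩ := Ideal.Quotient.mk_surjective (d.hom b)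
    refine ⟨a, ?_⟩
    have h1 := congrArg (fun t => t.hom a) hqe
    have h2 := congrArg (fun t => t.hom b) hid
    rw [← h1]
    refine Eq.trans ?_ h2
    change e.hom (Ideal.Quotient.mk J a) = e.hom (d.hom b)
    rw [ha]
  · have h1 := congrArg (fun t => t.hom a) hd
    refine Eq.trans h1.symm ?_
    change d.hom (r.hom a) = 0
    rw [ha, map_zero]

theorem absoluteFrobenius_appLE (p : ℕ) [Fact p.Prime] (X : Scheme.{u}) (h : (p : Γ(X, ⊤)) = 0)
    (V : X.Opens) (e : V ≤ (absoluteFrobenius p X h) ⁻¹ᵁ V) (b : Γ(X, V)) :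
    ((absoluteFrobenius p X h).appLE V V e).hom b = b ^ p := by
  have : X.presheaf.map (homOfLE (le_refl V)).op = 𝟙 _ := X.presheaf.map_id _
  change (X.presheaf.map (homOfLE (le_refl V)).op).hom (b ^ p) = b ^ p
  rw [this]
  rfl

theorem wittTwoResidue_surjective (p : ℕ) [Fact p.Prime] (k : Type*) [CommRing k] :
    Function.Surjective (wittTwoResidue p k) := fun a =>
  ⟨teich p a, teich_coeff_zero (p := p) a⟩

theorem surjective_specMap_wittTwoResidue (p : ℕ) [hp : Fact p.Prime] (k : Type u) [Field k]
    [CharP k p] [PerfectField k] :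
    Surjective (Spec.map (CommRingCat.ofHom (wittTwoResidue p k))) := by
  refine ⟨?_⟩
  refine (PrimeSpectrum.isHomeomorph_comap (wittTwoResidue p k) (fun x => ⟨1, one_pos, ?_⟩)
    (fun x hx => ?_)).surjective
  · obtain ⟨y, hy⟩ := wittTwoResidue_surjective p k x
    exact ⟨y, by rw [hy, pow_one]⟩
  · obtain ⟨y, rfl⟩ := wittTwo_eq_natCast_mul (p := p) (show x.coeff 0 = 0 from hx)
    refine ⟨2, ?_⟩
    have h0 : (p : WittTwo p k).coeff 0 = 0 := by
      rw [← CharP.cast_eq_zero k p]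
      exact map_natCast (wittTwoResidue p k) p
    have h1 : wittV p (0 : k) = 0 := wittTwo_ext p (by simp) (by simp)
    rw [mul_pow, sq (p : WittTwo p k), mul_natCast_eq_wittV, h0, zero_pow hp.out.ne_zero, h1,
      zero_mul]
    rfl

theorem surjective_appTop_specMap {W k : CommRingCat.{u}} {f : W ⟶ k}
    (hf : Function.Surjective f.hom) {p : ℕ} (hker : ∀ x, f.hom x = 0 → ∃ y, x = p * y) :
    Function.Surjective (Spec.map f).appTop.hom ∧
      ∀ x, (Spec.map f).appTop.hom x = 0 → ∃ y, x = p * y := by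
  let eW := (Scheme.ΓSpecIso W).commRingCatIsoToRingEquiv
  let ek := (Scheme.ΓSpecIso k).commRingCatIsoToRingEquiv
  have hnat : ∀ x, ek ((Spec.map f).appTop.hom x) = f.hom (eW x) := fun x =>
    congrArg (fun t => t.hom x) (Scheme.ΓSpecIso_naturality f)
  refine ⟨fun b => ?_, fun x hx => ?_⟩
  · obtain ⟨a, ha⟩ := hf (ek b)
    exact ⟨eW.symm a, ek.injective (by rw [hnat, eW.apply_symm_apply, ha])⟩
  · obtain ⟨y, hy⟩ := hker (eW x) (by rw [← hnat, hx, map_zero])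
    exact ⟨eW.symm y, eW.injective (by rw [hy, map_mul, map_natCast, eW.apply_symm_apply])⟩

/-- A Frobenius lifting of an affine scheme, read off on an affine neighbourhood of the image of
a local ring. -/
theorem IsFrobeniusLiftable.exists_ringHom {p : ℕ} [hp : Fact p.Prime] {k : Type u} [Field k]
    [CharP k p] [PerfectField k] {R : Type u} [CommRing R] [Algebra k R]
    (h : IsFrobeniusLiftable p (Spec.map (CommRingCat.ofHom (algebraMap k R))))
    {C : Type u} [CommRing C] [IsLocalRing C] (ρ : R →+* C) :
    ∃ (A B : Type u) (_ : CommRing A) (_ : CommRing B) (φ : A →+* A) (r : A →+* B) (θ : R →+* B)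
      (s : B →+* C), (∀ a, ∃ d, φ a = a ^ p + p * d) ∧
      (∀ a : A, (p : A) * a = 0 → ∃ b, a = p * b) ∧ Function.Surjective r ∧
      (∀ a, r a = 0 → ∃ b, a = p * b) ∧ s.comp θ = ρ := by
  obtain ⟨⟨Y, π, i, hflat, hpb⟩, F, -, hF⟩ := h
  dsimp only at F hF
  have hi : Surjective i := MorphismProperty.of_isPullback (P := @Surjective) hpb.flip
    (surjective_specMap_wittTwoResidue p k)
  -- `X → Y` is a surjection on points and absolute Frobenius fixes points, so `F` fixes points too.
  -- Hence every affine open of `Y` is stable under `F`.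
  have hFpt : ∀ y : Y, F y = y := by
    intro y
    obtain ⟨x, rfl⟩ := i.surjective y
    exact congrArg (fun t : Spec (CommRingCat.of R) ⟶ Y => t x) hF
  let g : Spec (CommRingCat.of C) ⟶ Spec (CommRingCat.of R) := Spec.map (CommRingCat.ofHom ρ)
  obtain ⟨U, hU, hxU, -⟩ := exists_isAffineOpen_mem_and_subset (X := Y) (U := ⊤)
    (x := i (g (IsLocalRing.closedPoint C))) trivial
  let V := i ⁻¹ᵁ U
  have hFU : F ⁻¹ᵁ U = U := by
    ext y
    exact iff_of_eq (congrArg (· ∈ U) (hFpt y))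
  -- An open set containing the closed point of a local scheme is everything, so the whole `C`-point
  -- factors through `V`.
  have hgV : g ⁻¹ᵁ V = ⊤ := (IsLocalRing.closedPoint_mem_iff _).1 hxU
  have htorsW : ∀ x : Γ(Spec (CommRingCat.of (WittTwo p k)), ⊤), p * x = 0 →
      ∃ y, x = p * y := by
    intro x hx
    let e := (Scheme.ΓSpecIso (CommRingCat.of (WittTwo p k))).commRingCatIsoToRingEquiv
    obtain ⟨y, hy⟩ := wittTwo_eq_natCast_mul (p := p) (x := e x) (wittTwo_mul_natCast_eq_zero (by
      rw [← map_natCast e, ← map_mul, hx, map_zero]))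
    exact ⟨e.symm y, e.injective (by rw [hy, map_mul, map_natCast, e.apply_symm_apply])⟩
  have htors : ∀ a : Γ(Y, U), (p : Γ(Y, U)) * a = 0 → ∃ b, a = p * b := fun a ha =>
    (π.flat_appLE (isAffineOpen_top _) hU le_top).exists_eq_natCast_mul p htorsW ha
  have hpush := (isIso_pushoutSection_iff hpb (US := ⊤) (UT := ⊤) (UX := U) (UY := V) le_top
    le_top (by simp [V])).1 (isIso_pushoutSection_of_isAffineOpen hpb le_top le_top (by simp [V])
      (isAffineOpen_top _) (isAffineOpen_top _) hU)
  have hjtop : Function.Surjective ((Spec.map (CommRingCat.ofHom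
      (wittTwoResidue p k))).appLE ⊤ ⊤ le_top).hom ∧ ∀ x, ((Spec.map (CommRingCat.ofHom
      (wittTwoResidue p k))).appLE ⊤ ⊤ le_top).hom x = 0 → ∃ y, x = p * y := by
    have heq : (Spec.map (CommRingCat.ofHom (wittTwoResidue p k))).appLE ⊤ ⊤ le_top =
        (Spec.map (CommRingCat.ofHom (wittTwoResidue p k))).appTop := Scheme.Hom.appLE_eq_app _
    rw [heq]
    exact surjective_appTop_specMap (wittTwoResidue_surjective p k)
      fun x hx => wittTwo_eq_natCast_mul hx
  have hk0 : (p : Γ(Spec (CommRingCat.of k), ⊤)) = 0 := natCast_eq_zero_of_over (k := k) (𝟙 _)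
  have hres := CommRingCat.surjective_of_isPushout_of_surjective hpush hjtop.1 p hk0 hjtop.2
  have hcomm : ∀ a, (i.appLE U V le_rfl).hom ((F.appLE U U hFU.ge).hom a) =
      (i.appLE U V le_rfl).hom a ^ p := by
    intro a
    have h1 : F.appLE U U hFU.ge ≫ i.appLE U V le_rfl = i.appLE U V le_rfl ≫
        (absoluteFrobenius p _ (natCast_eq_zero_of_over (Spec.map (CommRingCat.ofHom
          (algebraMap k R))))).appLE V V le_rfl := by
      refine (Scheme.Hom.appLE_comp_appLE i F U U V _ _).trans
        (Eq.trans ?_ (Scheme.Hom.appLE_comp_appLE _ i U V V _ _).symm)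
      simp only [hF]
    have h2 := congrArg (fun t => t.hom a) h1
    exact h2.trans (absoluteFrobenius_appLE p _ _ V _ _)
  refine ⟨Γ(Y, U), Γ(Spec (CommRingCat.of R), V), inferInstance, inferInstance,
    (F.appLE U U hFU.ge).hom, (i.appLE U V (by simp [V])).hom,
    ((Scheme.ΓSpecIso (CommRingCat.of R)).inv ≫
      (Spec (CommRingCat.of R)).presheaf.map (homOfLE le_top).op).hom,
    (g.appLE V ⊤ hgV.ge ≫ (Scheme.ΓSpecIso (CommRingCat.of C)).hom).hom, fun a => ?_, htors,
    hres.1, hres.2, ?_⟩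
  · obtain ⟨d, hd⟩ := hres.2 ((F.appLE U U hFU.ge).hom a - a ^ p) (by
      rw [map_sub, map_pow, hcomm, sub_self])
    exact ⟨d, by rw [← hd]; ring⟩
  · rw [← CommRingCat.hom_comp, Category.assoc, Scheme.Hom.map_appLE_assoc]
    have h1 : g.appLE ⊤ ⊤ le_top = (Spec.map (CommRingCat.ofHom ρ)).appTop :=
      Scheme.Hom.appLE_eq_app _
    rw [h1, Scheme.ΓSpecIso_naturality, Iso.inv_hom_id_assoc]
    rfl

/-! ### The contradiction -/

theorem mainTheorem3 {k : Type u} [Field k] [PerfectField k] (p : ℕ) [Fact p.Prime] [CharP k p]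
    (hp : 3 ≤ p) (n : ℕ) (hn : 5 ≤ n) (Q : MvPolynomial (Fin n) k)
    (hQ : ∀ m : Fin n →₀ ℕ, m.degree < 3 → Q.coeff m = 0) :
    ¬ IsFrobeniusLiftable p
      (hypersurfaceToSpec ((∑ i : Fin n, (MvPolynomial.X i : MvPolynomial (Fin n) k) ^ 2) + Q)) := by
  intro hlift
  obtain ⟨n, rfl⟩ := Nat.exists_eq_add_of_le' hn
  have hpp : p.Prime := Fact.out
  set f := (∑ i, (MvPolynomial.X i : MvPolynomial (Fin (n + 5)) k) ^ 2) + Q with hf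
  -- The closure supplies a square root of `-1`, needed for hyperbolic coordinates.
  let K := AlgebraicClosure k
  have _ : CharP K p := charP_of_injective_algebraMap (algebraMap k K).injective p
  obtain ⟨C, _, _, u, v, w, z, t, hI, hu, hv, hw, hz, ht, hrel, hne, hres⟩ :=
    exists_quadric_test_ring hp K
  have _ : Nontrivial C := nontrivial_of_ne _ _ hne
  have _ : CharP C p := charP_of_injective_algebraMap (algebraMap K C).injective p
  let _ : Algebra k C := ((algebraMap K C).comp (algebraMap k K)).toAlgebra
  set I := Ideal.span {u, v, w, z, t} with hIdef
  have hIp : ∀ a ∈ I, a ^ p = 0 := by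
    have hle : I ≤ RingHom.ker (frobenius C p) := by
      rw [hIdef, Ideal.span_le]
      have ht' : t ^ p = 0 := by
        rw [← Nat.sub_add_cancel hp, pow_add, ht, mul_zero]
      rintro x (rfl | rfl | rfl | rfl | rfl) <;> simpa [frobenius_def]
    exact fun a ha => hle ha
  have hloc : IsLocalRing C := by
    refine IsLocalRing.of_isUnit_or_isUnit_one_sub_self fun a => ?_
    obtain ⟨κ, hκ⟩ := hres a
    by_cases h0 : κ = 0
    · right
      rw [h0, map_zero, sub_zero] at hκ
      exact IsNilpotent.isUnit_one_sub ⟨p, hIp a hκ⟩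
    · left
      have := IsNilpotent.isUnit_add_left_of_commute ⟨p, hIp _ hκ⟩
        ((IsUnit.mk0 κ h0).map (algebraMap K C)) (Commute.all _ _)
      simpa using this
  obtain ⟨jK, hjK⟩ := IsAlgClosed.exists_pow_nat_eq (-1 : K) two_pos
  have h2K : (2 : K) ≠ 0 := by
    intro h
    have : (p : ℕ) ∣ 2 := (CharP.cast_eq_zero_iff K p 2).1 (by exact_mod_cast h)
    have := Nat.le_of_dvd two_pos this
    omega
  set h := algebraMap K C (2⁻¹) with hh
  set j := algebraMap K C jK with hj
  have h2 : 2 * h = 1 := by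
    rw [hh, ← map_ofNat (algebraMap K C) 2, ← map_mul, mul_inv_cancel₀ h2K, map_one]
  have hj2 : j ^ 2 = -1 := by rw [hj, ← map_pow, hjK, map_neg, map_one]
  set y := quadricPoint n h j u v w z t
  have hIy : I = Ideal.span (Set.range y) := span_range_quadricPoint n h2 hj2
  have hsumy : ∑ i, y i ^ 2 = 0 := by
    rw [sum_quadricPoint (fun x => x ^ 2) (by simp)]
    linear_combination hrel + (h ^ 2 * (u - v) ^ 2 + h ^ 2 * (w - z) ^ 2) * hj2 +
      (2 * h + 1) * (u * v + w * z) * h2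
  -- The precision is chosen so that the error lies in `I ^ (2p + 1) = 0`, making `c` an actual
  -- `C`-point of the hypersurface.
  obtain ⟨c, hc, hcf⟩ := exists_morse_coordinates hQ h2 y hIy (2 * p - 2)
  rw [show 2 * p - 2 + 3 = 2 * p + 1 by omega, hI, hsumy, sub_zero, Ideal.mem_bot] at hcf
  let ρ : MvPolynomial (Fin (n + 5)) k ⧸ Ideal.span {f} →+* C :=
    Ideal.Quotient.lift _ (MvPolynomial.aeval c).toRingHom fun a ha => by
      obtain ⟨b, rfl⟩ := Ideal.mem_span_singleton.1 ha
      change MvPolynomial.aeval c (f * b) = 0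
      rw [map_mul, hcf, zero_mul]
  obtain ⟨A, B, _, _, φ, r, θ, s, hφ, htors, hr, hker, hs⟩ := hlift.exists_ringHom ρ
  have hp2 : p ≠ 2 := by omega
  obtain ⟨γ, hγ⟩ := exists_sum_teich_sq_eq hI hIp hQ φ hφ htors r hr hker
    (θ.comp (Ideal.Quotient.mk _))
    (by rw [RingHom.comp_apply, Ideal.Quotient.eq_zero_iff_mem.2 (Ideal.mem_span_singleton_self f),
      map_zero]) s y (fun i => hIy ▸ Ideal.subset_span ⟨i, rfl⟩)
    (fun i => by
      have : s (θ (Ideal.Quotient.mk _ (MvPolynomial.X i))) = c i := by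
        rw [← RingHom.comp_apply s θ, hs]
        exact MvPolynomial.aeval_X c i
      rw [RingHom.comp_apply, this]
      exact hc i) hsumy
  rw [sum_quadricPoint (fun x => teich p (x ^ 2)) (by simp), ← add_assoc, ← add_assoc (teich p _),
    teich_hyperbolic hp2 h2 hj2 hu hv, teich_hyperbolic hp2 h2 hj2 hw hz, ← add_assoc] at hγ
  have hγ' := pow_eq_of_teich_sum_eq hp2 (by rw [pow_succ, ht, zero_mul]) hrel hγ
  obtain ⟨κ, hκ⟩ := hres γ
  -- Frobenius kills `I`, so `γ ^ p` is either zero or a unit, while `(uv) ^ (p - 1) t²` is neither.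
  have hpow : γ ^ p = algebraMap K C κ ^ p := by
    rw [← sub_eq_zero, ← sub_pow_char, hIp _ hκ]
  by_cases hκ0 : κ = 0
  · rw [hκ0, map_zero, zero_pow hpp.ne_zero] at hpow
    exact hne (by rw [← neg_eq_zero, ← hγ', hpow])
  · have hunit : IsUnit (γ ^ p) := by
      rw [hpow]
      exact ((IsUnit.mk0 κ hκ0).map (algebraMap K C)).pow p
    refine not_isUnit_zero (M₀ := C) ?_
    have := hunit.pow p
    rwa [hγ', hIp] at this
    exact I.neg_mem (Ideal.mul_mem_left _ _ (Ideal.pow_mem_of_mem _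
      (Ideal.subset_span (by simp)) 2 two_pos))
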